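/- Let $G$ be a compact group of unitary $p\times p$ matrices with identity $I$ and Haar probability measure $\eta$, let $x_1,\dots,x_N\in\mathbb{C}^p$ and $\epsilon>0$. For $i,j\in[N]=\{1,\dots,N\}$ and $A,B\in G$ put $$W_{ij}(A,B)=e^{-\|Ax_i-Bx_j\|^2/\epsilon},\qquad D_{ii}=\sum_{j=1}^N\int_G W_{ij}(I,C)\,d\eta(C),\qquad S_{ij}(A,B)=\frac{W_{ij}(A,B)}{\sqrt{D_{ii}}\sqrt{D_{jj}}},$$ and let $S^1=S$, $S^{t}_{ij}(A,B)=\sum_{k=1}^N\int_G S^{t-1}_{ik}(A,C)S_{kj}(C,B)\,d\eta(C)$ for $t\ge 2$. Write $(f\star g)(R)=\int_G f(A)g(AR)\,d\eta(A)$. For $t\geq 1$, the second-order moment of $i$ is the function $M_{t,i}(k,r,R)=\{S^t_{ik}(I,\cdot)\star S^t_{ir}(I,\cdot)\}(R)$ on $[N]^2\times G$, and the $G$-invariant diffusion distance $E_t(i,j)\ge 0$ is the $L^2$ distance of two such moments: $$E_t^2(i,j)=\sum_{k,r=1}^N\int_G\big(M_{t,i}(k,r,R)-M_{t,j}(k,r,R)\big)^2d\eta(R).$$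 Let $\{U^\ell\}_{\ell\in\mathcal I_G}$ list the finite-dimensional continuous irreducible unitary (matrix) representations of $G$, each exactly once up to equivalence, and let $d_\ell$ be the dimension of $U^\ell$. For each $\ell$ let $\hat W^{(\ell)}$ be the $Nd_\ell\times Nd_\ell$ matrix with $d_\ell\times d_\ell$ blocks $\hat W^\ell_{ij}=\int_G W_{ij}(I,A)\overline{U^\ell(A)}\,d\eta(A)$, let $D^{(\ell)}=\mathrm{diag}(D_{11}I_{d_\ell},\dots,D_{NN}I_{d_\ell})$, and let $v_{1,\ell},\dots,v_{Nd_\ell,\ell}$ be any orthonormal basis of $\mathbb{C}^{Nd_\ell}$ of eigenvectors of $S^{(\ell)}=(D^{(\ell)})^{-1/2}\hat W^{(\ell)}(D^{(\ell)})^{-1/2}$, with (real) eigenvalues $\lambda_{1,\ell},\dots,\lambda_{Nd_\ell,\ell}$. For $v\in\mathbb{C}^{Nd_\ell}$ let $e^i(v)\in\mathbb{C}^{d_\ell}$ be its $i$-th block of length $d_\ell$. Then for every integer $t\ge1$ the functions $M_{t,i}$ belong to $L^2([N]^2\times G)$, and for all $i,j\in[N]$ $$E_t^2(i,j)=\sum_{\ell\in\mathcal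 I_G}d_\ell\sum_{n,n'=1}^{Nd_\ell}(\lambda_{n,\ell}\lambda_{n',\ell})^{2t}\,\big|\langle e^i(v_{n,\ell}),e^i(v_{n',\ell})\rangle-\langle e^j(v_{n,\ell}),e^j(v_{n',\ell})\rangle\big|^2,$$ where the series converges. Moreover the sequences $$\Psi_t(i)=\Big(\sqrt{d_\ell}\,\lambda_{n,\ell}^t\lambda_{n',\ell}^t\,\langle e^i(v_{n,\ell}),e^i(v_{n',\ell})\rangle\Big)_{\ell\in\mathcal I_G,\;1\le n,n'\le Nd_\ell}$$ belong to $\ell^2$, satisfy $E_t(i,j)=\|\Psi_t(i)-\Psi_t(j)\|_{\ell^2}$ for all $i,j\in[N]$, and are $G$-invariant: if $x_j=Ax_i$ for some $A\in G$, then $\Psi_t(i)=\Psi_t(j)$. -/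

import Mathlib

open MeasureTheory Matrix

noncomputable section

namespace GInvDiffusion

/-! ### Unitary matrix groups acting on data points -/

/-- The action of a unitary matrix on `ℂᵖ` by matrix multiplication on the left. -/
def act {p : ℕ} (A : unitaryGroup (Fin p) ℂ) (x : EuclideanSpace ℂ (Fin p)) :
    EuclideanSpace ℂ (Fin p) :=
  WithLp.toLp 2 ((A : Matrix (Fin p) (Fin p) ℂ) *ᵥ x.ofLp)

/-! ### Irreducible unitary representations -/

section IUR

variable {G : Type*} [Group G]

/-- The linear representation on `ℂᵈ` given by a unitary matrix representation. -/
def toRep {d : ℕ} (U : G →* unitaryGroup (Fin d) ℂ) : Representation ℂ G (Fin d → ℂ) :=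
  ((Matrix.toLinAlgEquiv' : Matrix (Fin d) (Fin d) ℂ ≃ₐ[ℂ] ((Fin d → ℂ) →ₗ[ℂ] (Fin d → ℂ))) :
      Matrix (Fin d) (Fin d) ℂ →* ((Fin d → ℂ) →ₗ[ℂ] (Fin d → ℂ))).comp
    ((unitaryGroup (Fin d) ℂ).subtype.comp U)

/-- `U` is a (continuous) irreducible unitary representation, IUR for short. -/
structure IsIUR [TopologicalSpace G] {d : ℕ} (U : G →* unitaryGroup (Fin d) ℂ) : Prop where
  continuous : Continuous U
  irreducible : (toRep U).IsIrreducible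

/-- `U` enumerates the finite-dimensional IURs of `G`: it lists every one of them exactly once
up to equivalence of representations. -/
structure IsIUREnumeration [TopologicalSpace G] {I : Type*} {d : I → ℕ}
    (U : ∀ l : I, G →* unitaryGroup (Fin (d l)) ℂ) : Prop where
  isIUR : ∀ l, IsIUR (U l)
  inequivalent : ∀ l l', Nonempty ((toRep (U l)).Equiv (toRep (U l'))) → l = l'
  exhaustive : ∀ (n : ℕ) (V : G →* unitaryGroup (Fin n) ℂ), IsIUR V →
    ∃ l, Nonempty ((toRep V).Equiv (toRep (U l)))

end IUR

/-! ### The kernels on `[N] × G` -/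

section Kernels

variable {p N : ℕ} {G : Subgroup (unitaryGroup (Fin p) ℂ)}

/-- `W_{ij}(A, B) = exp (-‖A xᵢ - B xⱼ‖² / ε)`. -/
def affinity (ε : ℝ) (x : Fin N → EuclideanSpace ℂ (Fin p)) (i j : Fin N) (A B : G) : ℝ :=
  Real.exp (-‖act (A : unitaryGroup (Fin p) ℂ) (x i) - act (B : unitaryGroup (Fin p) ℂ) (x j)‖ ^ 2
    / ε)

variable [MeasurableSpace G]

/-- `D_{ii} = ∑ⱼ ∫ W_{ij}(I, C) dη(C)`. -/
def degree (η : Measure G) (ε : ℝ) (x : Fin N → EuclideanSpace ℂ (Fin p)) (i : Fin N) : ℝ :=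
  ∑ j, ∫ C, affinity ε x i j (1 : G) C ∂η

/-- `S_{ij}(A, B) = W_{ij}(A, B) / (√D_{ii} √D_{jj})`. -/
def symKernel (η : Measure G) (ε : ℝ) (x : Fin N → EuclideanSpace ℂ (Fin p))
    (i j : Fin N) (A B : G) : ℝ :=
  affinity ε x i j A B / (√(degree η ε x i) * √(degree η ε x j))

/-- The kernel of the operator power `S ^ t` for `t ≥ 1`: `S¹ = S` and
`S^{t+1}_{ij}(A, B) = ∑ₖ ∫ S^t_{ik}(A, C) S_{kj}(C, B) dη(C)`.
The value at `t = 0`, where there is no kernel function, is a placeholder. -/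
def symKernelPow (η : Measure G) (ε : ℝ) (x : Fin N → EuclideanSpace ℂ (Fin p)) :
    ℕ → Fin N → Fin N → G → G → ℝ
  | 0 => fun _ _ _ _ => 0
  | 1 => symKernel η ε x
  | t + 2 => fun i j A B =>
      ∑ k, ∫ C, symKernelPow η ε x (t + 1) i k A C * symKernel η ε x k j C B ∂η

/-- The cross-correlation `(f ⋆ g)(R) = ∫ f(A) g(A R) dη(A)`. -/
def crossCorr (η : Measure G) (f g : G → ℝ) (R : G) : ℝ :=
  ∫ A, f A * g (A * R) ∂η

/-- The second-order `G`-invariant moment of `S^t_{i,·}(I, ·)`, the function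
`(k, r, R) ↦ (S^t_{ik}(I, ·) ⋆ S^t_{ir}(I, ·))(R)` on `[N]² × G`. -/
def secondMoment (η : Measure G) (ε : ℝ) (x : Fin N → EuclideanSpace ℂ (Fin p)) (t : ℕ)
    (i k r : Fin N) (R : G) : ℝ :=
  crossCorr η (symKernelPow η ε x t i k 1) (symKernelPow η ε x t i r 1) R

/-- The diffusion distance `E_t(i, j)`: the distance in `L²([N]² × G)` between the second-order
moments of `i` and `j`. -/
def diffDist (η : Measure G) (ε : ℝ) (x : Fin N → EuclideanSpace ℂ (Fin p)) (t : ℕ)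
    (i j : Fin N) : ℝ :=
  √(∑ k, ∑ r, ∫ R, (secondMoment η ε x t i k r R - secondMoment η ε x t j k r R) ^ 2 ∂η)

/-! ### The Fourier block matrices -/

/-- The `Nd × Nd` matrix whose `(i, j)` block is `∫ W_{ij}(I, A) conj(U(A)) dη(A)`. -/
def fourierMatrix (η : Measure G) (ε : ℝ) (x : Fin N → EuclideanSpace ℂ (Fin p)) {d : ℕ}
    (U : G →* unitaryGroup (Fin d) ℂ) : Matrix (Fin N × Fin d) (Fin N × Fin d) ℂ :=
  Matrix.of fun q q' => ∫ A : G, (affinity ε x q.1 q'.1 1 A : ℂ) *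
    star ((U A : Matrix (Fin d) (Fin d) ℂ) q.2 q'.2) ∂η

/-- The inverse square root of the block diagonal matrix `diag(D₁₁ I_d, …, D_{NN} I_d)`. -/
def degreeInvSqrt (η : Measure G) (ε : ℝ) (x : Fin N → EuclideanSpace ℂ (Fin p)) (d : ℕ) :
    Matrix (Fin N × Fin d) (Fin N × Fin d) ℂ :=
  Matrix.diagonal fun q => (((√(degree η ε x q.1))⁻¹ : ℝ) : ℂ)

/-- `S^{(ℓ)} = (D^{(ℓ)})^{-1/2} Ŵ^{(ℓ)} (D^{(ℓ)})^{-1/2}`. -/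
def symFourierMatrix (η : Measure G) (ε : ℝ) (x : Fin N → EuclideanSpace ℂ (Fin p)) {d : ℕ}
    (U : G →* unitaryGroup (Fin d) ℂ) : Matrix (Fin N × Fin d) (Fin N × Fin d) ℂ :=
  degreeInvSqrt η ε x d * fourierMatrix η ε x U * degreeInvSqrt η ε x d

end Kernels

/-- `eⁱ(v)`, the `i`-th length-`d` block of a vector `v ∈ ℂ^{Nd}`. -/
def block {N d : ℕ} (i : Fin N) (v : EuclideanSpace ℂ (Fin N × Fin d)) :
    EuclideanSpace ℂ (Fin d) :=
  WithLp.toLp 2 fun a => v (i, a)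

end GInvDiffusion

end

noncomputable section

namespace GInvDiffusion

/-! ### Coefficients of matrix representations -/

section Coefficients

variable {G : Type*} [Group G]

/-! The kernel S is unchanged when both group variables are left translated together. Composing with
it is therefore convolution on G, and the Fourier transform at U^ℓ sends S^t_{ij}(I,·) to the (i,j)
block of (S^{(ℓ)})^t (`fourierCoeffMatrix_symKernelPow`). Cross-correlation becomes F(f)ᴴ F(g).
Expanding the powers in eigenvectors, the coefficients of the moment of i form the Nd×Nd matrix ∑
λ_n^t λ_n'^t ⟨e^i(v_n), e^i(v_n')⟩ v_n v_n'* (`fourierCoeffMatrix_secondMoment_eq_sum`). The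
matrices v_n v_n'* are Hilbert–Schmidt orthonormal, so Parseval on G (`hasSum_parseval`) turns the
L² distance of moments into the series.

Parseval needs Schur orthogonality and completeness of the irreducible coefficients. The
tautological representation of a matrix group is faithful, so the representative functions separate
points and are dense by Stone–Weierstrass. Each finite-dimensional invariant function space splits
into minimal ones, which consist of coefficients of irreducibles
(`le_span_coeffFamily_of_isLeftInvariant`).

Replacing x_i by A x_i only translates S^t_{ik}(I,·), which the cross-correlation does not see. Then
E_t(i,j) = 0, and the isometry forces Ψ_t(i) = Ψ_t(j). -/

lemma toRep_apply {d : ℕ} (U : G →* unitaryGroup (Fin d) ℂ) (g : G) (w : Fin d → ℂ) :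
    toRep U g w = (U g : Matrix (Fin d) (Fin d) ℂ) *ᵥ w := rfl

variable [TopologicalSpace G]

/-- The complex conjugate of a matrix coefficient of a unitary representation. -/
def conjCoeff {d : ℕ} (U : G →* unitaryGroup (Fin d) ℂ) (hU : Continuous U) (a b : Fin d) :
    C(G, ℂ) :=
  ⟨fun g => star ((U g : Matrix (Fin d) (Fin d) ℂ) a b),
    ((continuous_subtype_val.comp hU).matrix_elem a b).star⟩

lemma conjCoeff_apply {d : ℕ} (U : G →* unitaryGroup (Fin d) ℂ) (hU : Continuous U)
    (a b : Fin d) (g : G) :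
    conjCoeff U hU a b g = star ((U g : Matrix (Fin d) (Fin d) ℂ) a b) := rfl

lemma IsIUR.dim_ne_zero {n : ℕ} {V : G →* unitaryGroup (Fin n) ℂ} (hV : IsIUR V) : n ≠ 0 := by
  rintro rfl
  obtain ⟨a, b, hab⟩ := hV.irreducible.toNontrivial
  exact hab (Subrepresentation.toSubmodule_injective (Subsingleton.elim _ _))

/-- Coefficients of equivalent representations span the same space. -/
lemma conjCoeff_mem_span_of_equiv {d m : ℕ} {U : G →* unitaryGroup (Fin d) ℂ}
    {V : G →* unitaryGroup (Fin m) ℂ} (hU : Continuous U) (hV : Continuous V)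
    (e : (toRep V).Equiv (toRep U)) (a b : Fin m) :
    conjCoeff V hV a b ∈
      Submodule.span ℂ (Set.range fun q : Fin d × Fin d => conjCoeff U hU q.1 q.2) := by
  have h : conjCoeff V hV a b = ∑ c, ∑ c', star (e.symm (Pi.single c 1) a * e (Pi.single b 1) c') •
      conjCoeff U hU c c' := by
    ext g
    have h1 : (V g : Matrix (Fin m) (Fin m) ℂ) a b = toRep V g (Pi.single b 1) a := by
      simp [toRep_apply]
    have h2 : toRep V g (Pi.single b 1) = e.symm (toRep U g (e (Pi.single b 1))) := by
      have := Representation.IntertwiningMap.isIntertwining _ _ e.toIntertwiningMap g (Pi.single b 1)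
      simp only [Representation.Equiv.coe_toIntertwiningMap] at this
      rw [← this, Representation.Equiv.symm_apply_apply]
    have h3 : ∀ w : Fin d → ℂ, e.symm w a = ∑ c, w c * e.symm (Pi.single c 1) a := by
      intro w
      conv_lhs => rw [pi_eq_sum_univ' w, map_sum]
      simp [Finset.sum_apply]
    rw [conjCoeff_apply, h1, h2, h3]
    simp only [toRep_apply, Matrix.mulVec, dotProduct, ContinuousMap.coe_sum, Finset.sum_apply,
      ContinuousMap.smul_apply, conjCoeff_apply, smul_eq_mul, star_sum, star_mul', Finset.sum_mul]
    refine Finset.sum_congr rfl fun c _ => Finset.sum_congr rfl fun c' _ => ?_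
    ring
  rw [h]
  exact Submodule.sum_mem _ fun c _ => Submodule.sum_mem _ fun c' _ =>
    Submodule.smul_mem _ _ (Submodule.subset_span ⟨(c, c'), rfl⟩)

end Coefficients

/-! ### Representative functions on a topological group -/

section Translation

variable {G : Type*} [Group G] [TopologicalSpace G] [IsTopologicalGroup G]

/-- Left translation `(g • f)(x) = f (g⁻¹ x)` of continuous functions. -/
def leftTranslate (g : G) : C(G, ℂ) →⋆ₐ[ℂ] C(G, ℂ) :=
  ContinuousMap.compStarAlgHom' ℂ ℂ ⟨fun x => g⁻¹ * x, by fun_prop⟩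

@[simp]
lemma leftTranslate_apply (g : G) (f : C(G, ℂ)) (x : G) : leftTranslate g f x = f (g⁻¹ * x) := rfl

lemma leftTranslate_mul (g h : G) (f : C(G, ℂ)) :
    leftTranslate (g * h) f = leftTranslate g (leftTranslate h f) := by
  ext x
  simp [mul_assoc]

/-- Joint continuity curries to continuity into the compact-open topology; this is what makes the
representations built on function spaces continuous. -/
lemma continuous_leftTranslate (f : C(G, ℂ)) : Continuous fun g => leftTranslate g f := by
  have h : Continuous fun q : G × G => f (q.1⁻¹ * q.2) := by fun_prop
  exact (ContinuousMap.curry ⟨_, h⟩).continuous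

/-- A space of continuous functions is left invariant if it is stable under left translations. -/
def IsLeftInvariant (V : Submodule ℂ C(G, ℂ)) : Prop :=
  ∀ g : G, ∀ f ∈ V, leftTranslate g f ∈ V

lemma IsLeftInvariant.sup {V W : Submodule ℂ C(G, ℂ)} (hV : IsLeftInvariant V)
    (hW : IsLeftInvariant W) : IsLeftInvariant (V ⊔ W) := by
  intro g f hf
  obtain ⟨a, ha, b, hb, rfl⟩ := Submodule.mem_sup.1 hf
  rw [map_add]
  exact Submodule.add_mem_sup (hV g a ha) (hW g b hb)

lemma IsLeftInvariant.mul {V W : Submodule ℂ C(G, ℂ)} (hV : IsLeftInvariant V)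
    (hW : IsLeftInvariant W) : IsLeftInvariant (V * W) := by
  intro g f hf
  induction hf using Submodule.mul_induction_on' with
  | mem_mul_mem a ha b hb =>
    rw [map_mul]
    exact Submodule.mul_mem_mul (hV g a ha) (hW g b hb)
  | add a _ b _ iha ihb =>
    rw [map_add]
    exact add_mem iha ihb

lemma IsLeftInvariant.span {s : Set C(G, ℂ)}
    (hs : ∀ g : G, ∀ f ∈ s, leftTranslate g f ∈ Submodule.span ℂ s) :
    IsLeftInvariant (Submodule.span ℂ s) := by
  intro g f hf
  have h : Submodule.span ℂ s ≤ (Submodule.span ℂ s).comap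
      ((leftTranslate g : C(G, ℂ) →⋆ₐ[ℂ] C(G, ℂ)).toAlgHom.toLinearMap) :=
    Submodule.span_le.2 fun f hf => hs g f hf
  exact h hf

variable (G) in
/-- The representative functions: those lying in a finite-dimensional left invariant space. -/
def representativeFunctions : StarSubalgebra ℂ C(G, ℂ) where
  carrier := {f | ∃ V : Submodule ℂ C(G, ℂ), V.FG ∧ IsLeftInvariant V ∧ f ∈ V}
  mul_mem' := by
    rintro a b ⟨V, hV, hV', ha⟩ ⟨W, hW, hW', hb⟩
    exact ⟨V * W, hV.mul hW, hV'.mul hW', Submodule.mul_mem_mul ha hb⟩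
  add_mem' := by
    rintro a b ⟨V, hV, hV', ha⟩ ⟨W, hW, hW', hb⟩
    exact ⟨V ⊔ W, hV.sup hW, hV'.sup hW', Submodule.add_mem_sup ha hb⟩
  algebraMap_mem' := by
    intro c
    refine ⟨Submodule.span ℂ {1}, Submodule.fg_span_singleton _, IsLeftInvariant.span ?_, ?_⟩
    · rintro g f rfl
      rw [map_one]
      exact Submodule.mem_span_singleton_self _
    · exact Submodule.mem_span_singleton.2 ⟨c, (Algebra.algebraMap_eq_smul_one c).symm⟩
  star_mem' := by
    rintro a ⟨V, hV, hV', ha⟩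
    refine ⟨V.map (starLinearEquiv ℂ (A := C(G, ℂ))).toLinearMap, hV.map _, ?_, a, ha, rfl⟩
    rintro g _ ⟨b, hb, rfl⟩
    exact ⟨leftTranslate g b, hV' g b hb, (map_star (leftTranslate g) b).symm⟩

/-- Matrix coefficients of a continuous finite-dimensional matrix representation are
representative functions. -/
lemma matrixCoeff_mem_representativeFunctions {m : ℕ} (ρ : G →* Matrix (Fin m) (Fin m) ℂ)
    (hρ : Continuous ρ) (a b : Fin m) :
    (⟨fun g => ρ g a b, hρ.matrix_elem a b⟩ : C(G, ℂ)) ∈ representativeFunctions G := by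
  refine ⟨Submodule.span ℂ (Set.range fun q : Fin m × Fin m =>
    (⟨fun g => ρ g q.1 q.2, hρ.matrix_elem q.1 q.2⟩ : C(G, ℂ))),
    Submodule.fg_span (Set.finite_range _), IsLeftInvariant.span ?_,
    Submodule.subset_span ⟨(a, b), rfl⟩⟩
  rintro g _ ⟨⟨i, j⟩, rfl⟩
  have h : leftTranslate g (⟨fun g => ρ g i j, hρ.matrix_elem i j⟩ : C(G, ℂ)) =
      ∑ c, ρ g⁻¹ i c • (⟨fun g => ρ g c j, hρ.matrix_elem c j⟩ : C(G, ℂ)) := by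
    ext x
    simp [ContinuousMap.sum_apply, Matrix.mul_apply]
  rw [h]
  exact Submodule.sum_mem _ fun c _ => Submodule.smul_mem _ _ (Submodule.subset_span ⟨(c, j), rfl⟩)

end Translation

/-! ### The Peter–Weyl theorem for a group with enough representative functions -/

section Expansion

variable {G : Type*} [TopologicalSpace G] [CompactSpace G] [MeasurableSpace G] [BorelSpace G]
  (η : Measure G) [IsFiniteMeasure η] [η.IsOpenPosMeasure]

/-- A finite-dimensional space of continuous functions has an `L²`-orthonormal basis. -/
lemma exists_orthonormal_expansion {W : Submodule ℂ C(G, ℂ)} (hW : W.FG) :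
    ∃ (m : ℕ) (φ : Fin m → C(G, ℂ)), (∀ a, φ a ∈ W) ∧
      Orthonormal ℂ (fun a => ContinuousMap.toLp 2 η ℂ (φ a)) ∧
      ∀ f ∈ W, f = ∑ a, inner ℂ (ContinuousMap.toLp 2 η ℂ (φ a)) (ContinuousMap.toLp 2 η ℂ f) •
        φ a := by
  let W' := W.map (ContinuousMap.toLp (E := ℂ) 2 η ℂ).toLinearMap
  have : FiniteDimensional ℂ W' := .of_fg (hW.map _)
  let b := stdOrthonormalBasis ℂ W'
  have hb : ∀ a, ∃ f ∈ W, ContinuousMap.toLp 2 η ℂ f = (b a : Lp ℂ 2 η) := fun a => (b a).2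
  choose φ hφ hφb using hb
  refine ⟨_, φ, hφ, ?_, fun f hf => ?_⟩
  · simp_rw [hφb]
    exact b.orthonormal.comp_linearIsometry W'.subtypeₗᵢ
  -- η charges open sets, so an L² identity between continuous functions holds pointwise.
  · apply ContinuousMap.toLp_injective (p := 2) (𝕜 := ℂ) η
    have h := congrArg Subtype.val (b.sum_repr' ⟨ContinuousMap.toLp 2 η ℂ f, f, hf, rfl⟩)
    simp only [Submodule.coe_inner, Submodule.coe_sum, Submodule.coe_smul] at h
    simp only [map_sum, map_smul, hφb]
    exact h.symm

end Expansion

section Decomposition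

variable {G : Type*} [Group G] [TopologicalSpace G] [IsTopologicalGroup G] [CompactSpace G]
  [MeasurableSpace G] [BorelSpace G] (η : Measure G) [η.IsHaarMeasure] [IsProbabilityMeasure η]

lemma inner_toLp_leftTranslate (g : G) (f h : C(G, ℂ)) :
    inner ℂ (ContinuousMap.toLp 2 η ℂ (leftTranslate g f))
      (ContinuousMap.toLp 2 η ℂ (leftTranslate g h)) =
    inner ℂ (ContinuousMap.toLp 2 η ℂ f) (ContinuousMap.toLp 2 η ℂ h) := by
  rw [ContinuousMap.inner_toLp, ContinuousMap.inner_toLp]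
  exact integral_mul_left_eq_self (μ := η) (fun x => h x * (starRingEnd ℂ) (f x)) g⁻¹

include η in
/-- A finite-dimensional left invariant space of continuous functions carries, in an orthonormal
basis, a continuous unitary matrix representation. -/
lemma exists_unitaryRep {W : Submodule ℂ C(G, ℂ)} (hW : W.FG) (hinv : IsLeftInvariant W) :
    ∃ (m : ℕ) (φ : Fin m → C(G, ℂ)) (u : G →* unitaryGroup (Fin m) ℂ),
      (∀ a, φ a ∈ W) ∧ LinearIndependent ℂ φ ∧ W ≤ Submodule.span ℂ (Set.range φ) ∧
      Continuous u ∧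
      ∀ g b, leftTranslate g (φ b) = ∑ a, (u g : Matrix (Fin m) (Fin m) ℂ) a b • φ a := by
  obtain ⟨m, φ, hφ, hon, hexp⟩ := exists_orthonormal_expansion η hW
  let M : G → Matrix (Fin m) (Fin m) ℂ := fun g => Matrix.of fun a b =>
    inner ℂ (ContinuousMap.toLp 2 η ℂ (φ a)) (ContinuousMap.toLp 2 η ℂ (leftTranslate g (φ b)))
  have hM : ∀ g b, leftTranslate g (φ b) = ∑ a, M g a b • φ a := fun g b =>
    hexp _ (hinv g _ (hφ b))
  have hmul : ∀ g h, M (g * h) = M g * M h := by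
    intro g h
    ext a b
    rw [Matrix.mul_apply]
    change inner ℂ _ (ContinuousMap.toLp 2 η ℂ (leftTranslate (g * h) (φ b))) = _
    rw [leftTranslate_mul, hM h b]
    simp only [map_sum, map_smul, inner_sum, inner_smul_right]
    exact Finset.sum_congr rfl fun c _ => mul_comm _ _
  have hunit : ∀ g, M g ∈ unitaryGroup (Fin m) ℂ := by
    intro g
    rw [Matrix.mem_unitaryGroup_iff']
    ext a b
    have h1 := inner_toLp_leftTranslate η g (φ a) (φ b)
    rw [orthonormal_iff_ite.1 hon a b, hM g a, hM g b] at h1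
    simp only [map_sum, map_smul, sum_inner, inner_sum, inner_smul_left, inner_smul_right,
      orthonormal_iff_ite.1 hon] at h1
    simpa [Matrix.mul_apply, Matrix.star_apply, Matrix.one_apply, mul_comm] using h1
  have hcont : Continuous M := by
    refine continuous_matrix fun a b => ?_
    exact continuous_const.inner
      ((ContinuousMap.toLp (E := ℂ) 2 η ℂ).continuous.comp (continuous_leftTranslate (φ b)))
  refine ⟨m, φ, MonoidHom.mk' (fun g => ⟨M g, hunit g⟩) fun g h => Subtype.ext (hmul g h), hφ,
    LinearIndependent.of_comp (ContinuousMap.toLp (E := ℂ) 2 η ℂ).toLinearMap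
      hon.linearIndependent, ?_, hcont.subtype_mk _, hM⟩
  intro f hf
  rw [hexp f hf]
  exact Submodule.sum_mem _ fun a _ => Submodule.smul_mem _ _ (Submodule.subset_span ⟨a, rfl⟩)

include η in
/-- A minimal finite-dimensional left invariant space of continuous functions is contained in the
span of the conjugate coefficients of an irreducible unitary representation. -/
lemma exists_isIUR_le_span {W : Submodule ℂ C(G, ℂ)} (hW : W.FG) (hinv : IsLeftInvariant W)
    (hne : W ≠ ⊥) (hmin : ∀ W' ≤ W, IsLeftInvariant W' → W' = ⊥ ∨ W' = W) :
    ∃ (m : ℕ) (u : G →* unitaryGroup (Fin m) ℂ) (hu : IsIUR u),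
      W ≤ Submodule.span ℂ (Set.range fun q : Fin m × Fin m =>
        conjCoeff u hu.continuous q.1 q.2) := by
  obtain ⟨m, φ, u, hφ, hli, hspan, hcont, hu⟩ := exists_unitaryRep η hW hinv
  have hspan' : W = Submodule.span ℂ (Set.range φ) :=
    le_antisymm hspan (Submodule.span_le.2 (by rintro _ ⟨a, rfl⟩; exact hφ a))
  -- T identifies ℂᵐ with W and intertwines u with translation, so minimality of W becomes
  -- irreducibility of u.
  let T : (Fin m → ℂ) →ₗ[ℂ] C(G, ℂ) := Fintype.linearCombination ℂ φ
  have hT : Function.Injective T := linearIndependent_iff_injective_fintypeLinearCombination.1 hli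
  have hTapp : ∀ c, T c = ∑ a, c a • φ a := fun c => Fintype.linearCombination_apply ..
  have hTrange : LinearMap.range T = W := by
    rw [hspan']
    exact Fintype.range_linearCombination ℂ φ
  have hTinv : ∀ g c, leftTranslate g (T c) = T (toRep u g c) := by
    intro g c
    simp only [hTapp, map_sum, map_smul, hu, toRep_apply, Matrix.mulVec, dotProduct,
      Finset.smul_sum, Finset.sum_smul, smul_smul]
    rw [Finset.sum_comm]
    exact Finset.sum_congr rfl fun a _ => Finset.sum_congr rfl fun b _ => by rw [mul_comm]
  have hiur : IsIUR u := by
    refine ⟨hcont, ?_⟩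
    have hnt : Nontrivial (Subrepresentation (toRep u)) := by
      refine ⟨⊥, ⊤, fun h => hne ?_⟩
      have h' : (⊥ : Submodule ℂ (Fin m → ℂ)) = ⊤ := congrArg Subrepresentation.toSubmodule h
      rw [← hTrange, LinearMap.range_eq_map, ← h', Submodule.map_bot]
    refine ⟨fun K => ?_⟩
    have hK : IsLeftInvariant (K.toSubmodule.map T) := by
      rintro g _ ⟨c, hc, rfl⟩
      exact ⟨toRep u g c, K.apply_mem_toSubmodule g hc, (hTinv g c).symm⟩
    have hKW : K.toSubmodule.map T ≤ W := hTrange ▸ LinearMap.map_le_range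
    rcases hmin _ hKW hK with h | h
    · left
      apply Subrepresentation.toSubmodule_injective
      exact Submodule.map_injective_of_injective hT (h.trans (Submodule.map_bot T).symm)
    · right
      apply Subrepresentation.toSubmodule_injective
      apply Submodule.map_injective_of_injective hT
      rw [h, ← hTrange, LinearMap.range_eq_map]
      rfl
  refine ⟨m, u, hiur, hspan.trans (Submodule.span_le.2 ?_)⟩
  rintro _ ⟨b, rfl⟩
  -- Evaluate the translate by g⁻¹ at the identity, then use that the (a,b) entry of u(g⁻¹) is the
  -- conjugate of the (b,a) entry of u(g).
  have h : φ b = ∑ a, φ a 1 • conjCoeff u hiur.continuous b a := by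
    ext g
    have h1 := congrArg (fun f : C(G, ℂ) => f 1) (hu g⁻¹ b)
    simp only [leftTranslate_apply, inv_inv, mul_one, map_inv, ContinuousMap.coe_sum,
      Finset.sum_apply, ContinuousMap.smul_apply, smul_eq_mul] at h1
    rw [h1]
    simp only [ContinuousMap.coe_sum, Finset.sum_apply, ContinuousMap.smul_apply, smul_eq_mul,
      conjCoeff_apply]
    refine Finset.sum_congr rfl fun a _ => ?_
    rw [mul_comm]
    rfl
  rw [SetLike.mem_coe, h]
  exact Submodule.sum_mem _ fun a _ => Submodule.smul_mem _ _ (Submodule.subset_span ⟨(b, a), rfl⟩)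

/-- The conjugate coefficients of a family of continuous unitary representations. -/
def coeffFamily {I : Type*} {d : I → ℕ} (U : ∀ l : I, G →* unitaryGroup (Fin (d l)) ℂ)
    (hU : ∀ l, Continuous (U l)) (s : Σ l : I, Fin (d l) × Fin (d l)) : C(G, ℂ) :=
  conjCoeff (U s.1) (hU s.1) s.2.1 s.2.2

variable {I : Type*} {d : I → ℕ} {U : ∀ l : I, G →* unitaryGroup (Fin (d l)) ℂ}

include η in
-- Complete reducibility by strong induction on dimension: a minimal space comes from one
-- irreducible, and otherwise a proper nonzero invariant subspace and its L² complement in W are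
-- both invariant and smaller.
lemma le_span_coeffFamily_of_isLeftInvariant (hU : IsIUREnumeration U) (n : ℕ) :
    ∀ {W : Submodule ℂ C(G, ℂ)}, W.FG → IsLeftInvariant W → Module.finrank ℂ W = n →
      W ≤ Submodule.span ℂ (Set.range (coeffFamily U fun l => (hU.isIUR l).continuous)) := by
  induction n using Nat.strong_induction_on with
  | _ n ih =>
    intro W hW hinv hn
    have : FiniteDimensional ℂ W := .of_fg hW
    by_cases hmin : ∀ W' ≤ W, IsLeftInvariant W' → W' = ⊥ ∨ W' = W
    · by_cases hne : W = ⊥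
      · simp [hne]
      obtain ⟨m, u, hu, hle⟩ := exists_isIUR_le_span η hW hinv hne hmin
      obtain ⟨l, ⟨e⟩⟩ := hU.exhaustive m u hu
      refine hle.trans (Submodule.span_le.2 ?_)
      rintro _ ⟨⟨a, b⟩, rfl⟩
      refine Submodule.span_mono ?_
        (conjCoeff_mem_span_of_equiv (hU.isIUR l).continuous hu.continuous e a b)
      rintro _ ⟨q, rfl⟩
      exact ⟨⟨l, q⟩, rfl⟩
    · push Not at hmin
      obtain ⟨W₁, hle, hinv₁, hne₁, hne₂⟩ := hmin
      have hW₁ : FiniteDimensional ℂ W₁ := Submodule.finiteDimensional_of_le hle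
      let ι : C(G, ℂ) →ₗ[ℂ] Lp ℂ 2 η := (ContinuousMap.toLp (E := ℂ) 2 η ℂ).toLinearMap
      let W₂ : Submodule ℂ C(G, ℂ) := W ⊓ ((W₁.map ι)ᗮ).comap ι
      have hinv₂ : IsLeftInvariant W₂ := by
        rintro g f ⟨hf, hf'⟩
        refine ⟨hinv g f hf, ?_⟩
        rw [SetLike.mem_coe, Submodule.mem_comap, Submodule.mem_orthogonal]
        rintro _ ⟨h, hh, rfl⟩
        -- Writing h as a g-translate lets the unitarity of translation move g off f.
        have h1 : h = leftTranslate g (leftTranslate g⁻¹ h) := by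
          ext x
          simp
        rw [h1]
        refine (inner_toLp_leftTranslate η g _ f).trans ?_
        exact (Submodule.mem_orthogonal _ _).1 hf' _ ⟨_, hinv₁ g⁻¹ h hh, rfl⟩
      have hW₂ : FiniteDimensional ℂ W₂ := Submodule.finiteDimensional_of_le inf_le_left
      have hsup : W ≤ W₁ ⊔ W₂ := by
        intro f hf
        have : FiniteDimensional ℂ (W₁.map ι) := inferInstance
        obtain ⟨y, ⟨f₁, hf₁, rfl⟩, z, hz, hyz⟩ :=
          (W₁.map ι).exists_add_mem_mem_orthogonal (ι f)
        have h2 : ι (f - f₁) = z := by rw [map_sub, hyz, add_sub_cancel_left]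
        rw [← add_sub_cancel f₁ f]
        refine Submodule.add_mem_sup hf₁ ⟨sub_mem hf (hle hf₁), ?_⟩
        rw [SetLike.mem_coe, Submodule.mem_comap, h2]
        exact hz
      have hlt₂ : W₂ < W := by
        refine lt_of_le_of_ne inf_le_left fun h => hne₁ ?_
        rw [Submodule.eq_bot_iff]
        intro f hf
        have hf₂ : f ∈ W₂ := h ▸ hle hf
        have h0 : inner ℂ (ι f) (ι f) = 0 :=
          (Submodule.mem_orthogonal _ _).1 hf₂.2 _ ⟨f, hf, rfl⟩
        rw [inner_self_eq_zero] at h0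
        exact ContinuousMap.toLp_injective (p := 2) (𝕜 := ℂ) η (h0.trans (map_zero ι).symm)
      refine hsup.trans (sup_le ?_ ?_)
      · exact ih _ (hn ▸ Submodule.finrank_lt_finrank_of_lt (lt_of_le_of_ne hle hne₂))
          ((Submodule.fg_iff_finiteDimensional _).2 hW₁) hinv₁ rfl
      · exact ih _ (hn ▸ Submodule.finrank_lt_finrank_of_lt hlt₂)
          ((Submodule.fg_iff_finiteDimensional _).2 hW₂) hinv₂ rfl

include η in
/-- The coefficients of all irreducible unitary representations span a uniformly dense subspace,
once the representative functions separate points. -/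
theorem topologicalClosure_span_coeffFamily (hU : IsIUREnumeration U)
    (hsep : (representativeFunctions G).SeparatesPoints) :
    (Submodule.span ℂ (Set.range
      (coeffFamily U fun l => (hU.isIUR l).continuous))).topologicalClosure = ⊤ := by
  have h := ContinuousMap.starSubalgebra_topologicalClosure_eq_top_of_separatesPoints _ hsep
  rw [eq_top_iff]
  intro f _
  have hf : f ∈ (representativeFunctions G).topologicalClosure := h ▸ trivial
  refine closure_mono ?_ hf
  rintro a ⟨V, hV, hinv, ha⟩
  exact le_span_coeffFamily_of_isLeftInvariant η hU _ hV hinv rfl ha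

end Decomposition

/-! ### Schur orthogonality and Parseval's identity -/

section Schur

variable {G : Type*} [Group G] [TopologicalSpace G] [IsTopologicalGroup G] [CompactSpace G]
  [MeasurableSpace G] [BorelSpace G] (η : Measure G) [η.IsHaarMeasure]
  {d m : ℕ} {U : G →* unitaryGroup (Fin d) ℂ} {V : G →* unitaryGroup (Fin m) ℂ}

/-- The matrix `∫ U(g) E V(g)* dη(g)` for the elementary matrix `E` with entry `1` at `(b, e)`. -/
def averagedMatrix (U : G →* unitaryGroup (Fin d) ℂ) (V : G →* unitaryGroup (Fin m) ℂ)
    (b : Fin d) (e : Fin m) : Matrix (Fin d) (Fin m) ℂ :=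
  Matrix.of fun a c => ∫ g, (U g : Matrix (Fin d) (Fin d) ℂ) a b *
    star ((V g : Matrix (Fin m) (Fin m) ℂ) c e) ∂η

omit [IsTopologicalGroup G] in
lemma integrable_coeff_mul_star_coeff (hU : Continuous U) (hV : Continuous V) (a b : Fin d)
    (c e : Fin m) :
    Integrable (fun g => (U g : Matrix (Fin d) (Fin d) ℂ) a b *
      star ((V g : Matrix (Fin m) (Fin m) ℂ) c e)) η := by
  have h : Continuous fun g => (U g : Matrix (Fin d) (Fin d) ℂ) a b *
      star ((V g : Matrix (Fin m) (Fin m) ℂ) c e) :=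
    ((continuous_subtype_val.comp hU).matrix_elem a b).mul
      ((continuous_subtype_val.comp hV).matrix_elem c e).star
  exact h.integrable_of_hasCompactSupport (.of_compactSpace _)

omit [IsTopologicalGroup G] [η.IsHaarMeasure] in
lemma inner_conjCoeff [IsFiniteMeasure η] (hU : Continuous U) (hV : Continuous V)
    (a b : Fin d) (c e : Fin m) :
    inner ℂ (ContinuousMap.toLp 2 η ℂ (conjCoeff U hU a b))
      (ContinuousMap.toLp 2 η ℂ (conjCoeff V hV c e)) = averagedMatrix η U V b e a c := by
  rw [ContinuousMap.inner_toLp]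
  simp [averagedMatrix, conjCoeff_apply, mul_comm]

/-- The substitution g ↦ h⁻¹g in the Haar integral trades a factor U(h) on the left for V(h) on the
right. -/
lemma mul_averagedMatrix (hU : Continuous U) (hV : Continuous V) (b : Fin d) (e : Fin m) (h : G) :
    (U h : Matrix (Fin d) (Fin d) ℂ) * averagedMatrix η U V b e =
      averagedMatrix η U V b e * (V h : Matrix (Fin m) (Fin m) ℂ) := by
  ext a c
  simp only [Matrix.mul_apply, averagedMatrix, Matrix.of_apply]
  calc ∑ a', (U h : Matrix (Fin d) (Fin d) ℂ) a a' * ∫ g, (U g : Matrix (Fin d) (Fin d) ℂ) a' b *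
        star ((V g : Matrix (Fin m) (Fin m) ℂ) c e) ∂η
      = ∫ g, (U (h * g) : Matrix (Fin d) (Fin d) ℂ) a b *
        star ((V (h⁻¹ * (h * g)) : Matrix (Fin m) (Fin m) ℂ) c e) ∂η := by
        simp_rw [← integral_const_mul]
        rw [← integral_finsetSum _ fun a' _ =>
          (integrable_coeff_mul_star_coeff η hU hV a' b c e).const_mul _]
        simp [Matrix.mul_apply, Finset.sum_mul, mul_assoc]
    _ = ∫ g, (U g : Matrix (Fin d) (Fin d) ℂ) a b *
        star ((V (h⁻¹ * g) : Matrix (Fin m) (Fin m) ℂ) c e) ∂η :=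
        integral_mul_left_eq_self (μ := η) (fun g => (U g : Matrix (Fin d) (Fin d) ℂ) a b *
          star ((V (h⁻¹ * g) : Matrix (Fin m) (Fin m) ℂ) c e)) h
    _ = _ := by
        simp_rw [← integral_mul_const]
        rw [← integral_finsetSum _ fun c' _ =>
          (integrable_coeff_mul_star_coeff η hU hV a b c' e).mul_const _]
        refine integral_congr_ae (.of_forall fun g => ?_)
        have h1 : ∀ c', ((V h⁻¹ : unitaryGroup (Fin m) ℂ) : Matrix (Fin m) (Fin m) ℂ) c c' =
            star ((V h : Matrix (Fin m) (Fin m) ℂ) c' c) := fun c' => by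
          rw [map_inv]
          rfl
        simp only [map_mul, Submonoid.coe_mul, Matrix.mul_apply, h1, star_sum, star_mul',
          star_star, Finset.mul_sum]
        exact Finset.sum_congr rfl fun c' _ => by ring

/-- The averaged matrix as an intertwining map. -/
def averagedIntertwiner (hU : Continuous U) (hV : Continuous V) (b : Fin d) (e : Fin m) :
    (toRep V).IntertwiningMap (toRep U) where
  toLinearMap := Matrix.toLin' (averagedMatrix η U V b e)
  isIntertwining' g := by
    apply LinearMap.ext
    intro w
    simp [toRep_apply, Matrix.mulVec_mulVec, mul_averagedMatrix η hU hV]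

/-- Schur orthogonality for inequivalent representations. -/
lemma averagedMatrix_eq_zero (hU : IsIUR U) (hV : IsIUR V)
    (hne : IsEmpty ((toRep V).Equiv (toRep U))) (b : Fin d) (e : Fin m) :
    averagedMatrix η U V b e = 0 := by
  have := hU.irreducible
  have := hV.irreducible
  have h : averagedIntertwiner η hU.continuous hV.continuous b e = 0 := Subsingleton.elim _ _
  have h' : Matrix.toLin' (averagedMatrix η U V b e) = 0 :=
    congrArg Representation.IntertwiningMap.toLinearMap h
  simpa using h'

/-- Schur orthogonality for the coefficients of one representation. -/
lemma averagedMatrix_self [IsProbabilityMeasure η] (hU : IsIUR U) (b e : Fin d) :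
    (d : ℂ) • averagedMatrix η U U b e = if b = e then 1 else 0 := by
  have := hU.irreducible
  obtain ⟨c, hc⟩ :=
    (Representation.IsIrreducible.algebraMap_intertwiningMap_bijective_of_isAlgClosed
      (ρ := toRep U)).2 (averagedIntertwiner η hU.continuous hU.continuous b e)
  have h1 : averagedMatrix η U U b e = c • (1 : Matrix (Fin d) (Fin d) ℂ) := by
    apply Matrix.toLin'.injective
    rw [map_smul, Matrix.toLin'_one]
    exact (congrArg Representation.IntertwiningMap.toLinearMap hc).symm
  -- The trace determines the scalar given by Schur's lemma: conjugation by U(g) preserves the trace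
  -- of the elementary matrix.
  have h2 : (averagedMatrix η U U b e).trace = if b = e then 1 else 0 := by
    simp only [Matrix.trace, Matrix.diag, averagedMatrix, Matrix.of_apply]
    rw [← integral_finsetSum _ fun a _ =>
      integrable_coeff_mul_star_coeff η hU.continuous hU.continuous a b a e]
    have h3 : ∀ g, ∑ a, (U g : Matrix (Fin d) (Fin d) ℂ) a b *
        star ((U g : Matrix (Fin d) (Fin d) ℂ) a e) = if b = e then 1 else 0 := by
      intro g
      have h4 := congrFun (congrFun (Matrix.mem_unitaryGroup_iff'.1 (U g).2) e) b
      simp only [Matrix.mul_apply, Matrix.star_apply, Matrix.one_apply] at h4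
      simp_rw [eq_comm (a := b), ← h4, mul_comm]
    simp_rw [h3]
    simp
  rw [h1] at h2 ⊢
  rw [smul_smul, mul_comm]
  simp only [Matrix.trace_smul, Matrix.trace_one, Fintype.card_fin, smul_eq_mul] at h2
  rw [h2]
  split_ifs <;> simp

end Schur

section Parseval

variable {G : Type*} [Group G] [TopologicalSpace G] [IsTopologicalGroup G] [CompactSpace G]
  [MeasurableSpace G] [BorelSpace G] (η : Measure G) [η.IsHaarMeasure] [IsProbabilityMeasure η]
  {I : Type*} {d : I → ℕ} {U : ∀ l : I, G →* unitaryGroup (Fin (d l)) ℂ}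

/-- The normalized conjugate coefficients, as elements of `L²`. -/
def normalizedCoeff (hU : IsIUREnumeration U) (s : Σ l : I, Fin (d l) × Fin (d l)) : Lp ℂ 2 η :=
  ((√(d s.1 : ℝ) : ℝ) : ℂ) •
    ContinuousMap.toLp 2 η ℂ (coeffFamily U (fun l => (hU.isIUR l).continuous) s)

/-- The two factors √d_ℓ cancel the 1/d_ℓ in Schur orthogonality. -/
lemma orthonormal_normalizedCoeff (hU : IsIUREnumeration U) :
    Orthonormal ℂ (normalizedCoeff η hU) := by
  classical
  rw [orthonormal_iff_ite]
  rintro ⟨l, a, b⟩ ⟨l', c, e⟩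
  simp only [normalizedCoeff, coeffFamily, inner_smul_left, inner_smul_right, inner_conjCoeff,
    Complex.conj_ofReal]
  by_cases hl : l = l'
  · subst hl
    have h1 := congrFun (congrFun (averagedMatrix_self η (hU.isIUR l) b e) a) c
    have h2 : ((√(d l : ℝ) : ℝ) : ℂ) * ((√(d l : ℝ) : ℝ) : ℂ) = d l := by
      rw [← Complex.ofReal_mul, Real.mul_self_sqrt (Nat.cast_nonneg _), Complex.ofReal_natCast]
    rw [← mul_assoc, h2]
    rw [Matrix.smul_apply, smul_eq_mul] at h1
    rw [h1]
    by_cases hb : b = e <;> simp [hb, Matrix.one_apply]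
  · have hne : IsEmpty ((toRep (U l')).Equiv (toRep (U l))) :=
      ⟨fun e => hl (hU.inequivalent l' l ⟨e⟩).symm⟩
    rw [averagedMatrix_eq_zero η (hU.isIUR l) (hU.isIUR l') hne]
    simp [hl]

/-- Uniform density among continuous functions passes to L² because these are dense there; the
factors √d_ℓ are nonzero and do not change the span. -/
lemma topologicalClosure_span_normalizedCoeff [T2Space G] [η.WeaklyRegular]
    (hU : IsIUREnumeration U) (hsep : (representativeFunctions G).SeparatesPoints) :
    (Submodule.span ℂ (Set.range (normalizedCoeff η hU))).topologicalClosure = ⊤ := by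
  have h := (ContinuousMap.toLp_denseRange ℂ η ℂ
    (ENNReal.ofNat_ne_top (n := 2))).topologicalClosure_map_submodule
      (topologicalClosure_span_coeffFamily η hU hsep)
  rw [eq_top_iff, ← h]
  refine Submodule.topologicalClosure_mono ?_
  rw [Submodule.map_span]
  refine Submodule.span_le.2 ?_
  rintro _ ⟨_, ⟨s, rfl⟩, rfl⟩
  have hd : ((√(d s.1 : ℝ) : ℝ) : ℂ) ≠ 0 := by
    have h := (hU.isIUR s.1).dim_ne_zero
    simpa using h
  have h3 : ContinuousMap.toLp 2 η ℂ (coeffFamily U (fun l => (hU.isIUR l).continuous) s) =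
      ((√(d s.1 : ℝ) : ℝ) : ℂ)⁻¹ • normalizedCoeff η hU s := by
    rw [normalizedCoeff, smul_smul, inv_mul_cancel₀ hd, one_smul]
  change ContinuousMap.toLp 2 η ℂ (coeffFamily U (fun l => (hU.isIUR l).continuous) s) ∈ _
  rw [h3]
  exact Submodule.smul_mem _ _ (Submodule.subset_span ⟨s, rfl⟩)

/-- The Fourier coefficient `∫ f(A) conj(U(A)) dη(A)`. -/
def fourierCoeffMatrix {n : ℕ} (V : G →* unitaryGroup (Fin n) ℂ) (f : G → ℝ) :
    Matrix (Fin n) (Fin n) ℂ :=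
  Matrix.of fun a b => ∫ A, (f A : ℂ) * star ((V A : Matrix (Fin n) (Fin n) ℂ) a b) ∂η

/-- Parseval's identity for real continuous functions. -/
theorem hasSum_parseval [T2Space G] [η.WeaklyRegular]
    (hU : IsIUREnumeration U) (hsep : (representativeFunctions G).SeparatesPoints)
    {f : G → ℝ} (hf : Continuous f) :
    HasSum (fun l => (d l : ℝ) * ∑ a, ∑ b, ‖fourierCoeffMatrix η (U l) f a b‖ ^ 2)
      (∫ A, f A ^ 2 ∂η) := by
  let B : HilbertBasis _ ℂ (Lp ℂ 2 η) := HilbertBasis.mk (orthonormal_normalizedCoeff η hU)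
    (topologicalClosure_span_normalizedCoeff η hU hsep).ge
  let F : C(G, ℂ) := ⟨fun A => (f A : ℂ), Complex.continuous_ofReal.comp hf⟩
  let x : Lp ℂ 2 η := ContinuousMap.toLp 2 η ℂ F
  have h1 := B.hasSum_inner_mul_inner x x
  have hx : inner ℂ x x = ((∫ A, f A ^ 2 ∂η : ℝ) : ℂ) := by
    rw [ContinuousMap.inner_toLp, ← integral_complex_ofReal]
    simp [F, sq]
  have hB : ∀ s, inner ℂ x (B s) * inner ℂ (B s) x = ((‖inner ℂ (B s) x‖ ^ 2 : ℝ) : ℂ) := by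
    intro s
    rw [← inner_conj_symm x, Complex.conj_mul']
    norm_cast
  simp_rw [hx, hB] at h1
  have h2 := (Complex.hasSum_ofReal.1 h1)
  have h3 := h2.sigma fun l => hasSum_fintype _
  convert h3 using 2 with l
  rw [Fintype.sum_prod_type, Finset.mul_sum]
  refine Finset.sum_congr rfl fun a _ => ?_
  rw [Finset.mul_sum]
  refine Finset.sum_congr rfl fun b _ => ?_
  -- The basis vectors are conjugate coefficients and f is real, so a conjugate appears here; it
  -- disappears in the norm.
  have h4 : inner ℂ (B ⟨l, a, b⟩) x = ((√(d l : ℝ) : ℝ) : ℂ) *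
      star (fourierCoeffMatrix η (U l) f a b) := by
    rw [HilbertBasis.coe_mk, normalizedCoeff, inner_smul_left, Complex.conj_ofReal,
      ContinuousMap.inner_toLp]
    congr 1
    simp only [fourierCoeffMatrix, Matrix.of_apply, Complex.star_def]
    rw [← integral_conj]
    simp [F, coeffFamily, conjCoeff_apply]
  rw [h4, norm_mul, mul_pow, norm_star, Complex.norm_real, Real.norm_eq_abs, sq_abs,
    Real.sq_sqrt (Nat.cast_nonneg _)]

end Parseval

/-! ### Fourier coefficients of convolutions and cross-correlations -/

section Convolution

variable {G : Type*} [Group G] [TopologicalSpace G] [IsTopologicalGroup G] [CompactSpace G]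
  [MeasurableSpace G] [BorelSpace G] (η : Measure G) [η.IsHaarMeasure]
  {n : ℕ} {V : G →* unitaryGroup (Fin n) ℂ}

lemma continuous_integral_mul_translate {f g : G → ℝ} (hf : Continuous f) (hg : Continuous g)
    {φ : G → G} (hφ : Continuous φ) : Continuous fun R => ∫ A, f A * g (φ A * R) ∂η := by
  rw [← continuousOn_univ]
  refine continuousOn_integral_of_compact_support isCompact_univ (Continuous.continuousOn ?_)
    fun p x _ hx => absurd (Set.mem_univ x) hx
  simp only [Function.uncurry_def]
  fun_prop

/-- Fubini, then R ↦ φ(A)⁻¹R in the inner integral. Taking φ to be inversion gives convolution, and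
the identity gives cross-correlation. -/
lemma integral_integral_mul_translate_mul_star (hV : Continuous V) {f g : G → ℝ}
    (hf : Continuous f) (hg : Continuous g) {φ : G → G} (hφ : Continuous φ) (a b : Fin n) :
    fourierCoeffMatrix η V (fun R => ∫ A, f A * g (φ A * R) ∂η) a b =
      ∑ c, (∫ A, (f A : ℂ) * (V (φ A) : Matrix (Fin n) (Fin n) ℂ) c a ∂η) *
        fourierCoeffMatrix η V g c b := by
  have hVc : ∀ i j, Continuous fun A => (V A : Matrix (Fin n) (Fin n) ℂ) i j := fun i j =>
    (continuous_subtype_val.comp hV).matrix_elem i j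
  have hfC : Continuous fun A => (f A : ℂ) := Complex.continuous_ofReal.comp hf
  have hgC : Continuous fun A => (g A : ℂ) := Complex.continuous_ofReal.comp hg
  have hint : ∀ {F : G → ℂ}, Continuous F → Integrable F η := fun hF =>
    hF.integrable_of_hasCompactSupport (.of_compactSpace _)
  calc fourierCoeffMatrix η V (fun R => ∫ A, f A * g (φ A * R) ∂η) a b
      = ∫ R, ∫ A, (f A : ℂ) * (g (φ A * R) : ℂ) *
          star ((V R : Matrix (Fin n) (Fin n) ℂ) a b) ∂η ∂η := by
        simp only [fourierCoeffMatrix, Matrix.of_apply, ← integral_complex_ofReal,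
          ← integral_mul_const, Complex.ofReal_mul]
    _ = ∫ A, ∫ R, (f A : ℂ) * (g (φ A * R) : ℂ) *
          star ((V R : Matrix (Fin n) (Fin n) ℂ) a b) ∂η ∂η := by
        refine integral_integral_swap_of_hasCompactSupport ?_ (.of_compactSpace _)
        simp only [Function.uncurry_def]
        have h1 : Continuous fun q : G × G => star ((V q.1 : Matrix (Fin n) (Fin n) ℂ) a b) :=
          ((hVc a b).comp continuous_fst).star
        have h2 : Continuous fun q : G × G => (g (φ q.2 * q.1) : ℂ) :=
          hgC.comp (by fun_prop : Continuous fun q : G × G => φ q.2 * q.1)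
        exact ((hfC.comp continuous_snd).mul h2).mul h1
    _ = ∫ A, ∑ c, ((f A : ℂ) * (V (φ A) : Matrix (Fin n) (Fin n) ℂ) c a) *
          fourierCoeffMatrix η V g c b ∂η := by
        refine integral_congr_ae (.of_forall fun A => ?_)
        dsimp only
        have h1 : ∫ R, (f A : ℂ) * (g (φ A * R) : ℂ) *
            star ((V R : Matrix (Fin n) (Fin n) ℂ) a b) ∂η =
            ∫ R, (f A : ℂ) * (g R : ℂ) *
              star ((V ((φ A)⁻¹ * R) : Matrix (Fin n) (Fin n) ℂ) a b) ∂η := by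
          rw [← integral_mul_left_eq_self (μ := η) (fun R => (f A : ℂ) * (g R : ℂ) *
              star ((V ((φ A)⁻¹ * R) : Matrix (Fin n) (Fin n) ℂ) a b)) (φ A)]
          simp
        have h2 : ∀ c, ((V (φ A)⁻¹ : unitaryGroup (Fin n) ℂ) : Matrix (Fin n) (Fin n) ℂ) a c =
            star ((V (φ A) : Matrix (Fin n) (Fin n) ℂ) c a) := fun c => by
          rw [map_inv]
          rfl
        rw [h1]
        simp only [fourierCoeffMatrix, Matrix.of_apply, ← integral_const_mul]
        have h3 : ∀ c, Integrable (fun R => (f A : ℂ) * (V (φ A) : Matrix (Fin n) (Fin n) ℂ) c a *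
            ((g R : ℂ) * star ((V R : Matrix (Fin n) (Fin n) ℂ) c b))) η := fun c =>
          hint (continuous_const.mul (hgC.mul (hVc c b).star))
        rw [← integral_finsetSum _ fun c _ => h3 c]
        refine integral_congr_ae (.of_forall fun R => ?_)
        simp only [map_mul, Submonoid.coe_mul, Matrix.mul_apply, h2, star_sum, star_mul',
          star_star, Finset.mul_sum]
        exact Finset.sum_congr rfl fun c _ => by ring
    _ = _ := by
        have h3 : ∀ c, Integrable (fun A => (f A : ℂ) * (V (φ A) : Matrix (Fin n) (Fin n) ℂ) c a *
            fourierCoeffMatrix η V g c b) η := fun c =>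
          hint ((hfC.mul ((hVc c a).comp hφ)).mul continuous_const)
        rw [integral_finsetSum _ fun c _ => h3 c]
        simp_rw [integral_mul_const]

/-- The Fourier transform takes convolution to the matrix product. -/
lemma fourierCoeffMatrix_convolution (hV : Continuous V) {f g : G → ℝ} (hf : Continuous f)
    (hg : Continuous g) :
    fourierCoeffMatrix η V (fun B => ∫ C, f C * g (C⁻¹ * B) ∂η) =
      fourierCoeffMatrix η V f * fourierCoeffMatrix η V g := by
  ext a b
  rw [integral_integral_mul_translate_mul_star η hV hf hg continuous_inv, Matrix.mul_apply]
  refine Finset.sum_congr rfl fun c _ => ?_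
  congr 1
  refine integral_congr_ae (.of_forall fun A => ?_)
  dsimp only
  rw [map_inv]
  rfl

/-- The Fourier transform of a cross-correlation. -/
lemma fourierCoeffMatrix_crossCorr (hV : Continuous V) {f g : G → ℝ} (hf : Continuous f)
    (hg : Continuous g) :
    fourierCoeffMatrix η V (fun R => ∫ A, f A * g (A * R) ∂η) =
      (fourierCoeffMatrix η V f)ᴴ * fourierCoeffMatrix η V g := by
  ext a b
  refine (integral_integral_mul_translate_mul_star η hV hf hg continuous_id a b).trans ?_
  rw [Matrix.mul_apply]
  refine Finset.sum_congr rfl fun c _ => ?_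
  congr 1
  simp only [Matrix.conjTranspose_apply, fourierCoeffMatrix, Matrix.of_apply, Complex.star_def]
  rw [← integral_conj]
  simp

end Convolution

/-! ### Fourier coefficients of the kernels -/

section KernelFourier

variable {p N : ℕ} {G : Subgroup (unitaryGroup (Fin p) ℂ)}

lemma act_mul (A B : unitaryGroup (Fin p) ℂ) (y : EuclideanSpace ℂ (Fin p)) :
    act (A * B) y = act A (act B y) := by
  simp [act, Matrix.mulVec_mulVec]

lemma norm_act (A : unitaryGroup (Fin p) ℂ) (y : EuclideanSpace ℂ (Fin p)) :
    ‖act A y‖ = ‖y‖ := by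
  have h : ∀ z : EuclideanSpace ℂ (Fin p), ((‖z‖ ^ 2 : ℝ) : ℂ) = star z.ofLp ⬝ᵥ z.ofLp := by
    intro z
    rw [dotProduct_comm, ← EuclideanSpace.inner_eq_star_dotProduct, inner_self_eq_norm_sq_to_K]
    norm_cast
  have h2 : ((‖act A y‖ ^ 2 : ℝ) : ℂ) = ((‖y‖ ^ 2 : ℝ) : ℂ) := by
    rw [h, h]
    simp only [act, Matrix.star_mulVec, Matrix.dotProduct_mulVec, Matrix.vecMul_vecMul]
    rw [← Matrix.star_eq_conjTranspose, Matrix.mem_unitaryGroup_iff'.1 A.2, Matrix.vecMul_one]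
  exact (sq_eq_sq₀ (norm_nonneg _) (norm_nonneg _)).1 (Complex.ofReal_injective h2)

lemma act_sub (A : unitaryGroup (Fin p) ℂ) (y z : EuclideanSpace ℂ (Fin p)) :
    act A (y - z) = act A y - act A z := by
  simp [act, Matrix.mulVec_sub]

lemma continuous_act (y : EuclideanSpace ℂ (Fin p)) :
    Continuous fun A : unitaryGroup (Fin p) ℂ => act A y :=
  (PiLp.continuous_toLp 2 _).comp (continuous_subtype_val.matrix_mulVec continuous_const)

variable (ε : ℝ) (x : Fin N → EuclideanSpace ℂ (Fin p))

lemma affinity_mul_left (i j : Fin N) (C A B : G) :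
    affinity ε x i j (C * A) (C * B) = affinity ε x i j A B := by
  simp only [affinity, Subgroup.coe_mul, act_mul, ← act_sub, norm_act]

lemma continuous_affinity (i j : Fin N) (A : G) : Continuous (affinity ε x i j A) := by
  have h := (continuous_act (x j)).comp (continuous_subtype_val (p := (· ∈ G)))
  unfold affinity
  exact Real.continuous_exp.comp (((continuous_const.sub h).norm.pow 2).neg.div_const ε)

variable [MeasurableSpace G] (η : Measure G)

lemma symKernel_mul_left (i j : Fin N) (C A B : G) :
    symKernel η ε x i j (C * A) (C * B) = symKernel η ε x i j A B := by
  rw [symKernel, symKernel, affinity_mul_left]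

lemma continuous_symKernel (i j : Fin N) (A : G) : Continuous (symKernel η ε x i j A) :=
  (continuous_affinity ε x i j A).div_const _

lemma symKernelPow_one : symKernelPow η ε x 1 = symKernel η ε x := rfl

/-- The bound on t excludes the placeholder at t = 0, from which the recursion would yield 0 instead
of S. -/
lemma symKernelPow_succ {t : ℕ} (ht : 1 ≤ t) (i j : Fin N) (A B : G) :
    symKernelPow η ε x (t + 1) i j A B =
      ∑ k, ∫ C, symKernelPow η ε x t i k A C * symKernel η ε x k j C B ∂η := by
  obtain ⟨t, rfl⟩ := Nat.exists_eq_add_of_le' ht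
  rfl

/-- Left invariance rewrites S(C, B) as S(I, C⁻¹B), which makes the composition a convolution. -/
lemma symKernelPow_succ_one {t : ℕ} (ht : 1 ≤ t) (i j : Fin N) (B : G) :
    symKernelPow η ε x (t + 1) i j 1 B =
      ∑ k, ∫ C, symKernelPow η ε x t i k 1 C * symKernel η ε x k j 1 (C⁻¹ * B) ∂η := by
  rw [symKernelPow_succ ε x η ht]
  refine Finset.sum_congr rfl fun k _ => integral_congr_ae (.of_forall fun C => ?_)
  dsimp only
  rw [← symKernel_mul_left ε x η k j C⁻¹ C B, inv_mul_cancel]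

lemma fourierCoeffMatrix_symKernel {n : ℕ} {V : G →* unitaryGroup (Fin n) ℂ} (i j : Fin N)
    (a b : Fin n) :
    fourierCoeffMatrix η V (symKernel η ε x i j 1) a b =
      symFourierMatrix η ε x V (i, a) (j, b) := by
  simp only [symFourierMatrix, degreeInvSqrt, fourierMatrix, Matrix.mul_diagonal,
    Matrix.diagonal_mul, fourierCoeffMatrix, Matrix.of_apply, symKernel]
  rw [← integral_const_mul, ← integral_mul_const]
  refine integral_congr_ae (.of_forall fun A => ?_)
  dsimp only
  push_cast
  rw [div_eq_mul_inv, mul_inv]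
  ring

variable [BorelSpace G] [η.IsHaarMeasure]

lemma symKernelPow_mul_left {t : ℕ} (ht : 1 ≤ t) (i j : Fin N) (C A B : G) :
    symKernelPow η ε x t i j (C * A) (C * B) = symKernelPow η ε x t i j A B := by
  induction t, ht using Nat.le_induction generalizing j B with
  | base => exact symKernel_mul_left ε x η i j C A B
  | succ t ht ih =>
    rw [symKernelPow_succ ε x η ht, symKernelPow_succ ε x η ht]
    refine Finset.sum_congr rfl fun k _ => ?_
    rw [← integral_mul_left_eq_self (μ := η) _ C]
    simp_rw [ih, symKernel_mul_left]

variable [CompactSpace G]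

lemma continuous_symKernelPow {t : ℕ} (ht : 1 ≤ t) (i j : Fin N) :
    Continuous (symKernelPow η ε x t i j 1) := by
  induction t, ht using Nat.le_induction generalizing j with
  | base => exact continuous_symKernel ε x η i j 1
  | succ t ht ih =>
    rw [funext (symKernelPow_succ_one ε x η ht i j)]
    exact continuous_finsetSum _ fun k _ =>
      continuous_integral_mul_translate η (ih k) (continuous_symKernel ε x η k j 1) continuous_inv

lemma continuous_secondMoment {t : ℕ} (ht : 1 ≤ t) (i k r : Fin N) :
    Continuous (secondMoment η ε x t i k r) :=
  continuous_integral_mul_translate η (continuous_symKernelPow ε x η ht i k)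
    (continuous_symKernelPow ε x η ht i r) continuous_id

variable {n : ℕ} {V : G →* unitaryGroup (Fin n) ℂ}

/-- Convolution supplies the product of blocks and the sum over k completes it to block matrix
multiplication. -/
lemma fourierCoeffMatrix_symKernelPow (hV : Continuous V) {t : ℕ} (ht : 1 ≤ t) (i j : Fin N)
    (a b : Fin n) :
    fourierCoeffMatrix η V (symKernelPow η ε x t i j 1) a b =
      (symFourierMatrix η ε x V ^ t) (i, a) (j, b) := by
  induction t, ht using Nat.le_induction generalizing j b with
  | base =>
    rw [pow_one]
    exact fourierCoeffMatrix_symKernel ε x η i j a b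
  | succ t ht ih =>
    have h1 : ∀ k, fourierCoeffMatrix η V (fun B => ∫ C, symKernelPow η ε x t i k 1 C *
        symKernel η ε x k j 1 (C⁻¹ * B) ∂η) a b =
        ∑ c, (symFourierMatrix η ε x V ^ t) (i, a) (k, c) *
          symFourierMatrix η ε x V (k, c) (j, b) := by
      intro k
      rw [fourierCoeffMatrix_convolution η hV (continuous_symKernelPow ε x η ht i k)
        (continuous_symKernel ε x η k j 1), Matrix.mul_apply]
      simp_rw [ih, fourierCoeffMatrix_symKernel]
    rw [pow_succ, Matrix.mul_apply, Fintype.sum_prod_type]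
    simp_rw [← h1]
    simp only [fourierCoeffMatrix, Matrix.of_apply]
    rw [← integral_finsetSum]
    · refine integral_congr_ae (.of_forall fun B => ?_)
      dsimp only
      rw [symKernelPow_succ_one ε x η ht, Complex.ofReal_sum, Finset.sum_mul]
    · intro k _
      have h2 := continuous_integral_mul_translate η (continuous_symKernelPow ε x η ht i k)
        (continuous_symKernel ε x η k j 1) continuous_inv
      have h3 := ((continuous_subtype_val.comp hV).matrix_elem a b).star
      exact ((Complex.continuous_ofReal.comp h2).mul h3).integrable_of_hasCompactSupport
        (.of_compactSpace _)

lemma fourierCoeffMatrix_secondMoment (hV : Continuous V) {t : ℕ} (ht : 1 ≤ t) (i k r : Fin N)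
    (a b : Fin n) :
    fourierCoeffMatrix η V (secondMoment η ε x t i k r) a b =
      ∑ c, star ((symFourierMatrix η ε x V ^ t) (i, c) (k, a)) *
        (symFourierMatrix η ε x V ^ t) (i, c) (r, b) := by
  refine (congrFun (congrFun (fourierCoeffMatrix_crossCorr η hV
    (continuous_symKernelPow ε x η ht i k) (continuous_symKernelPow ε x η ht i r)) a) b).trans ?_
  simp_rw [Matrix.mul_apply, Matrix.conjTranspose_apply,
    fourierCoeffMatrix_symKernelPow ε x η hV ht]

end KernelFourier

/-! ### Spectral expansion -/

section Spectral

variable {q n : Type*} [Fintype q] [Fintype n]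

lemma pow_mulVec_eigenvector [DecidableEq q] {P : Matrix q q ℂ} {w : q → ℂ} {μ : ℂ}
    (h : P *ᵥ w = μ • w) (t : ℕ) : (P ^ t) *ᵥ w = μ ^ t • w := by
  induction t with
  | zero => simp
  | succ t ih =>
    rw [pow_succ, ← Matrix.mulVec_mulVec, h, Matrix.mulVec_smul, ih, smul_smul, pow_succ']

/-- Expand the b-th standard basis vector in the eigenbasis and apply the power to each term. -/
lemma pow_apply_eq_sum [DecidableEq q] {P : Matrix q q ℂ}
    (v : OrthonormalBasis n ℂ (EuclideanSpace ℂ q)) {μ : n → ℂ}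
    (h : ∀ k, P *ᵥ (v k).ofLp = μ k • (v k).ofLp) (t : ℕ) (a b : q) :
    (P ^ t) a b = ∑ k, μ k ^ t * (v k a * star (v k b)) := by
  have h1 := congrArg WithLp.ofLp (v.sum_repr' (EuclideanSpace.single b (1 : ℂ)))
  simp only [EuclideanSpace.inner_single_right, WithLp.ofLp_sum, WithLp.ofLp_smul, one_mul] at h1
  have h2 : (P ^ t) a b = ((P ^ t) *ᵥ (EuclideanSpace.single b (1 : ℂ)).ofLp) a := by
    simp
  rw [h2, ← h1, Matrix.mulVec_sum, Finset.sum_apply]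
  refine Finset.sum_congr rfl fun k _ => ?_
  rw [Matrix.mulVec_smul, pow_mulVec_eigenvector (h k)]
  simp only [Pi.smul_apply, smul_eq_mul, Complex.star_def]
  ring

lemma sum_norm_sq_sum_mul (v : OrthonormalBasis n ℂ (EuclideanSpace ℂ q)) (c : n → ℂ) :
    ∑ a, ‖∑ k, c k * v k a‖ ^ 2 = ∑ k, ‖c k‖ ^ 2 := by
  have h1 : ∀ a, ∑ k, c k * v k a = (∑ k, c k • v k) a := by
    intro a
    simp
  simp_rw [h1]
  rw [← EuclideanSpace.norm_sq_eq, ← v.sum_sq_norm_inner_right]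
  refine Finset.sum_congr rfl fun k _ => ?_
  rw [v.orthonormal.inner_right_fintype]

/-- The rank-one matrices v_k v_k'* are orthonormal for the Hilbert–Schmidt product; the proof
applies Parseval in ℂ^q once to each index. -/
lemma sum_norm_sq_sum_mul_star (v : OrthonormalBasis n ℂ (EuclideanSpace ℂ q)) (c : n → n → ℂ) :
    ∑ a, ∑ b, ‖∑ k, ∑ k', c k k' * (v k a * star (v k' b))‖ ^ 2 = ∑ k, ∑ k', ‖c k k'‖ ^ 2 := by
  have h1 : ∀ a b, ∑ k, ∑ k', c k k' * (v k a * star (v k' b)) =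
      ∑ k, (∑ k', c k k' * star (v k' b)) * v k a := by
    intro a b
    simp_rw [Finset.sum_mul]
    exact Finset.sum_congr rfl fun k _ => Finset.sum_congr rfl fun k' _ => by ring
  have h2 : ∀ k b, ‖∑ k', c k k' * star (v k' b)‖ = ‖∑ k', star (c k k') * v k' b‖ := by
    intro k b
    rw [← norm_star]
    simp [star_sum, mul_comm]
  rw [Finset.sum_comm]
  simp_rw [h1, sum_norm_sq_sum_mul v, h2]
  rw [Finset.sum_comm]
  simp_rw [sum_norm_sq_sum_mul v, norm_star]

end Spectral

/-! ### Second moments in the eigenbasis and the diffusion distance -/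

section Embedding

variable {p N : ℕ} {G : Subgroup (unitaryGroup (Fin p) ℂ)}

/-- The inclusion of G into the matrices is a faithful continuous representation, so its entries
already separate points. -/
lemma separatesPoints_representativeFunctions :
    (representativeFunctions G).SeparatesPoints := by
  intro A B hAB
  let ρ : G →* Matrix (Fin p) (Fin p) ℂ := (unitaryGroup (Fin p) ℂ).subtype.comp G.subtype
  have hρ : Continuous ρ := continuous_subtype_val.comp continuous_subtype_val
  have h1 : ρ A ≠ ρ B := fun h => hAB (Subtype.ext (Subtype.ext h))
  have h2 : ∃ a b, ρ A a b ≠ ρ B a b := by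
    by_contra! h
    exact h1 (Matrix.ext h)
  obtain ⟨a, b, hab⟩ := h2
  exact ⟨_, ⟨_, matrixCoeff_mem_representativeFunctions ρ hρ a b, rfl⟩, hab⟩

lemma inner_block {d : ℕ} (i : Fin N) (w w' : EuclideanSpace ℂ (Fin N × Fin d)) :
    inner ℂ (block i w) (block i w') = ∑ c, star (w (i, c)) * w' (i, c) := by
  simp [PiLp.inner_apply, block, mul_comm]

/-- The coefficients `λₙᵗ λₙ'ᵗ ⟨eⁱ(vₙ), eⁱ(vₙ')⟩`. -/
def momentCoeff {d n : ℕ} (lam : Fin n → ℝ)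
    (v : OrthonormalBasis (Fin n) ℂ (EuclideanSpace ℂ (Fin N × Fin d))) (t : ℕ) (i : Fin N)
    (k k' : Fin n) : ℂ :=
  ((lam k ^ t * lam k' ^ t : ℝ) : ℂ) * inner ℂ (block i (v k)) (block i (v k'))

lemma diffDist_sq [MeasurableSpace G] (η : Measure G) (ε : ℝ)
    (x : Fin N → EuclideanSpace ℂ (Fin p)) (t : ℕ) (i j : Fin N) :
    diffDist η ε x t i j ^ 2 =
      ∑ k, ∑ r, ∫ R, (secondMoment η ε x t i k r R - secondMoment η ε x t j k r R) ^ 2 ∂η :=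
  Real.sq_sqrt (Finset.sum_nonneg fun _ _ => Finset.sum_nonneg fun _ _ =>
    integral_nonneg fun _ => sq_nonneg _)

variable [CompactSpace G] [MeasurableSpace G] [BorelSpace G] (η : Measure G) [η.IsHaarMeasure]
  (ε : ℝ) (x : Fin N → EuclideanSpace ℂ (Fin p))

/-- Both copies of S^t share the row block i; summing over its inner index c produces ⟨e^i(v_m),
e^i(v_m')⟩. Real eigenvalues survive the conjugation of the first copy. -/
lemma fourierCoeffMatrix_secondMoment_eq_sum {d n : ℕ} {V : G →* unitaryGroup (Fin d) ℂ}
    (hV : Continuous V) {lam : Fin n → ℝ}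
    (v : OrthonormalBasis (Fin n) ℂ (EuclideanSpace ℂ (Fin N × Fin d)))
    (hv : ∀ k, symFourierMatrix η ε x V *ᵥ (v k).ofLp = (lam k : ℂ) • (v k).ofLp)
    {t : ℕ} (ht : 1 ≤ t) (i k r : Fin N) (a b : Fin d) :
    fourierCoeffMatrix η V (secondMoment η ε x t i k r) a b =
      ∑ m, ∑ m', momentCoeff lam v t i m m' * (v m (k, a) * star (v m' (r, b))) := by
  rw [fourierCoeffMatrix_secondMoment ε x η hV ht]
  simp_rw [pow_apply_eq_sum v hv, momentCoeff, inner_block, star_sum, Finset.sum_mul_sum,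
    Finset.mul_sum, Finset.sum_mul]
  rw [Finset.sum_comm]
  refine Finset.sum_congr rfl fun m _ => ?_
  rw [Finset.sum_comm]
  refine Finset.sum_congr rfl fun m' _ => Finset.sum_congr rfl fun c _ => ?_
  simp only [star_mul', star_pow, Complex.star_def, Complex.conj_ofReal, Complex.conj_conj]
  push_cast
  ring

lemma fourierCoeffMatrix_sub {n : ℕ} {V : G →* unitaryGroup (Fin n) ℂ} (hV : Continuous V)
    {f g : G → ℝ} (hf : Continuous f) (hg : Continuous g) :
    fourierCoeffMatrix η V (fun A => f A - g A) =
      fourierCoeffMatrix η V f - fourierCoeffMatrix η V g := by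
  ext a b
  have h : ∀ {f : G → ℝ}, Continuous f → Integrable (fun A => (f A : ℂ) *
      star ((V A : Matrix (Fin n) (Fin n) ℂ) a b)) η := fun hf =>
    ((Complex.continuous_ofReal.comp hf).mul ((continuous_subtype_val.comp hV).matrix_elem
      a b).star).integrable_of_hasCompactSupport (.of_compactSpace _)
  simp only [fourierCoeffMatrix, Matrix.of_apply, Matrix.sub_apply]
  rw [← integral_sub (h hf) (h hg)]
  simp [sub_mul]

variable [IsProbabilityMeasure η] {I : Type*} {d : I → ℕ}
  {U : ∀ l : I, G →* unitaryGroup (Fin (d l)) ℂ}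

/-- Parseval's identity for a matrix of functions whose Fourier coefficients are expanded in
orthonormal bases of `ℂ^{Nd}`. -/
lemma hasSum_sum_integral_sq (hU : IsIUREnumeration U)
    (v : ∀ l : I, OrthonormalBasis (Fin (N * d l)) ℂ (EuclideanSpace ℂ (Fin N × Fin (d l))))
    {H : Fin N → Fin N → G → ℝ} (hH : ∀ k r, Continuous (H k r))
    (c : ∀ l : I, Fin (N * d l) → Fin (N * d l) → ℂ)
    (hc : ∀ l k r a b, fourierCoeffMatrix η (U l) (H k r) a b =
      ∑ m, ∑ m', c l m m' * (v l m (k, a) * star (v l m' (r, b)))) :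
    HasSum (fun l => (d l : ℝ) * ∑ m, ∑ m', ‖c l m m'‖ ^ 2)
      (∑ k, ∑ r, ∫ R, H k r R ^ 2 ∂η) := by
  have h := hasSum_sum (s := Finset.univ) fun k _ => hasSum_sum (s := Finset.univ) fun r _ =>
    hasSum_parseval η hU separatesPoints_representativeFunctions (hH k r)
  refine h.congr_fun fun l => ?_
  rw [← sum_norm_sq_sum_mul_star (v l)]
  simp_rw [Fintype.sum_prod_type, ← hc, ← Finset.mul_sum]
  congr 1
  refine Finset.sum_congr rfl fun k _ => ?_
  rw [Finset.sum_comm]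

lemma hasSum_diffDist_sq (hU : IsIUREnumeration U) {lam : ∀ l : I, Fin (N * d l) → ℝ}
    (v : ∀ l : I, OrthonormalBasis (Fin (N * d l)) ℂ (EuclideanSpace ℂ (Fin N × Fin (d l))))
    (hv : ∀ l n, symFourierMatrix η ε x (U l) *ᵥ (v l n).ofLp = (lam l n : ℂ) • (v l n).ofLp)
    {t : ℕ} (ht : 1 ≤ t) (i j : Fin N) :
    HasSum (fun l => (d l : ℝ) * ∑ m, ∑ m',
      ‖momentCoeff (lam l) (v l) t i m m' - momentCoeff (lam l) (v l) t j m m'‖ ^ 2)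
      (diffDist η ε x t i j ^ 2) := by
  rw [diffDist_sq]
  refine hasSum_sum_integral_sq η hU v (fun k r => (continuous_secondMoment ε x η ht i k r).sub
    (continuous_secondMoment ε x η ht j k r)) _ fun l k r a b => ?_
  refine (congrFun (congrFun (fourierCoeffMatrix_sub η (hU.isIUR l).continuous
    (continuous_secondMoment ε x η ht i k r) (continuous_secondMoment ε x η ht j k r)) a) b).trans ?_
  rw [Matrix.sub_apply,
    fourierCoeffMatrix_secondMoment_eq_sum η ε x (hU.isIUR l).continuous (v l) (hv l) ht,
    fourierCoeffMatrix_secondMoment_eq_sum η ε x (hU.isIUR l).continuous (v l) (hv l) ht]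
  simp_rw [← Finset.sum_sub_distrib, ← sub_mul]

end Embedding

/-! ### Invariance -/

section Invariance

variable {p N : ℕ} {G : Subgroup (unitaryGroup (Fin p) ℂ)} (ε : ℝ)
  {x : Fin N → EuclideanSpace ℂ (Fin p)}

lemma affinity_of_eq_act {i j : Fin N} {A : G}
    (h : x j = act (A : unitaryGroup (Fin p) ℂ) (x i)) (k : Fin N) (B C : G) :
    affinity ε x j k B C = affinity ε x i k (B * A) C := by
  simp only [affinity, Subgroup.coe_mul, act_mul, h]

variable [MeasurableSpace G] [BorelSpace G] (η : Measure G) [η.IsHaarMeasure]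

lemma degree_of_eq_act {i j : Fin N} {A : G}
    (h : x j = act (A : unitaryGroup (Fin p) ℂ) (x i)) : degree η ε x j = degree η ε x i := by
  refine Finset.sum_congr rfl fun k _ => ?_
  rw [← integral_mul_left_eq_self (μ := η) _ A]
  refine integral_congr_ae (.of_forall fun C => ?_)
  dsimp only
  rw [affinity_of_eq_act ε h, one_mul, ← affinity_mul_left ε x i k A 1 C, mul_one]

/-- Moving the data point by A shifts the first group variable on the right; in the recursion only
the left factor depends on the point, so the shift persists. -/
lemma symKernelPow_of_eq_act {i j : Fin N} {A : G}
    (h : x j = act (A : unitaryGroup (Fin p) ℂ) (x i)) {t : ℕ} (ht : 1 ≤ t) (k : Fin N)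
    (B C : G) : symKernelPow η ε x t j k B C = symKernelPow η ε x t i k (B * A) C := by
  induction t, ht using Nat.le_induction generalizing k C with
  | base =>
    rw [symKernelPow_one, symKernel, symKernel, affinity_of_eq_act ε h, degree_of_eq_act ε η h]
  | succ t ht ih =>
    simp_rw [symKernelPow_succ ε x η ht, ih]

/-- Both correlated functions are left translated by the same element, which Haar invariance
absorbs. -/
lemma secondMoment_of_eq_act {i j : Fin N} {A : G}
    (h : x j = act (A : unitaryGroup (Fin p) ℂ) (x i)) {t : ℕ} (ht : 1 ≤ t) (k r : Fin N) (R : G) :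
    secondMoment η ε x t j k r R = secondMoment η ε x t i k r R := by
  have h1 : ∀ k B, symKernelPow η ε x t j k 1 B = symKernelPow η ε x t i k 1 (A⁻¹ * B) := by
    intro k B
    rw [symKernelPow_of_eq_act ε η h ht, one_mul, ← symKernelPow_mul_left ε x η ht i k A⁻¹ A B,
      inv_mul_cancel]
  simp only [secondMoment, crossCorr, h1, ← mul_assoc]
  exact integral_mul_left_eq_self (μ := η) (fun B => symKernelPow η ε x t i k 1 B *
    symKernelPow η ε x t i r 1 (B * R)) A⁻¹

end Invariance

end GInvDiffusion

end

theorem proposition4p5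
    {p N : ℕ} (G : Subgroup (Matrix.unitaryGroup (Fin p) ℂ)) [CompactSpace G]
    [MeasurableSpace G] [BorelSpace G]
    (η : Measure G) [η.IsHaarMeasure] [IsProbabilityMeasure η]
    (ε : ℝ) (hε : 0 < ε) (x : Fin N → EuclideanSpace ℂ (Fin p))
    {I : Type*} (d : I → ℕ) (U : ∀ l : I, G →* Matrix.unitaryGroup (Fin (d l)) ℂ)
    (hU : GInvDiffusion.IsIUREnumeration U)
    (lam : ∀ l : I, Fin (N * d l) → ℝ)
    (v : ∀ l : I, OrthonormalBasis (Fin (N * d l)) ℂ (EuclideanSpace ℂ (Fin N × Fin (d l))))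
    (hv : ∀ l n, GInvDiffusion.symFourierMatrix η ε x (U l) *ᵥ (v l n).ofLp
      = (lam l n : ℂ) • (v l n).ofLp)
    (t : ℕ) (ht : 1 ≤ t) :
    (∀ i k r, MemLp (GInvDiffusion.secondMoment η ε x t i k r) 2 η) ∧
    (∀ i j, HasSum
      (fun l : I => (d l : ℝ) * ∑ n, ∑ n', (lam l n * lam l n') ^ (2 * t) *
        ‖inner ℂ (GInvDiffusion.block i (v l n)) (GInvDiffusion.block i (v l n'))
          - inner ℂ (GInvDiffusion.block j (v l n)) (GInvDiffusion.block j (v l n'))‖ ^ 2)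
      (GInvDiffusion.diffDist η ε x t i j ^ 2)) ∧
    ∃ Ψ : Fin N → lp (fun _ : (Σ l : I, Fin (N * d l) × Fin (N * d l)) => ℂ) 2,
      (∀ i l n n', Ψ i ⟨l, (n, n')⟩ = ((√(d l : ℝ) * (lam l n ^ t * lam l n' ^ t) : ℝ) : ℂ) *
        inner ℂ (GInvDiffusion.block i (v l n)) (GInvDiffusion.block i (v l n'))) ∧
      (∀ i j, GInvDiffusion.diffDist η ε x t i j = ‖Ψ i - Ψ j‖) ∧
      (∀ i j, (∃ A : G, x j = GInvDiffusion.act (A : Matrix.unitaryGroup (Fin p) ℂ) (x i)) →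
        Ψ i = Ψ j) := by
  open GInvDiffusion in
  let ψ : Fin N → (Σ l : I, Fin (N * d l) × Fin (N * d l)) → ℂ := fun i s =>
    ((√(d s.1 : ℝ) : ℝ) : ℂ) * momentCoeff (lam s.1) (v s.1) t i s.2.1 s.2.2
  -- The terms are nonnegative, so summability of the finite block sums over ℓ gives summability
  -- over all triples (ℓ, n, n').
  have hsum : ∀ (c : ∀ l, Fin (N * d l) → Fin (N * d l) → ℂ) (σ : ℝ),
      HasSum (fun l => (d l : ℝ) * ∑ m, ∑ m', ‖c l m m'‖ ^ 2) σ →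
      HasSum (fun s : Σ l : I, Fin (N * d l) × Fin (N * d l) =>
        ‖((√(d s.1 : ℝ) : ℝ) : ℂ) * c s.1 s.2.1 s.2.2‖ ^ 2) σ := by
    intro c σ h
    have h1 : ∀ (l : I) (m m' : Fin (N * d l)), ‖((√(d l : ℝ) : ℝ) : ℂ) * c l m m'‖ ^ 2 =
        (d l : ℝ) * ‖c l m m'‖ ^ 2 := by
      intro l m m'
      rw [norm_mul, mul_pow, Complex.norm_real, Real.norm_eq_abs, sq_abs,
        Real.sq_sqrt (Nat.cast_nonneg _)]
    have h2 : ∀ l, ∑' q : Fin (N * d l) × Fin (N * d l),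
        ‖((√(d l : ℝ) : ℝ) : ℂ) * c l q.1 q.2‖ ^ 2 =
        (d l : ℝ) * ∑ m, ∑ m', ‖c l m m'‖ ^ 2 := by
      intro l
      rw [tsum_fintype, Fintype.sum_prod_type]
      simp_rw [h1, Finset.mul_sum]
    have h3 : Summable (fun s : Σ l : I, Fin (N * d l) × Fin (N * d l) =>
        ‖((√(d s.1 : ℝ) : ℝ) : ℂ) * c s.1 s.2.1 s.2.2‖ ^ 2) := by
      rw [summable_sigma_of_nonneg fun _ => sq_nonneg _]
      exact ⟨fun l => (hasSum_fintype _).summable, by simpa only [h2] using h.summable⟩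
    have h4 : σ = ∑' s : Σ l : I, Fin (N * d l) × Fin (N * d l),
        ‖((√(d s.1 : ℝ) : ℝ) : ℂ) * c s.1 s.2.1 s.2.2‖ ^ 2 := by
      rw [h3.tsum_sigma]
      simp_rw [h2]
      exact h.tsum_eq.symm
    rw [h4]
    exact h3.hasSum
  have hmem : ∀ i, Memℓp (ψ i) 2 := by
    intro i
    refine memℓp_gen ?_
    -- Square summability of one sequence is Parseval for a single moment, with no difference taken.
    have h := hasSum_sum_integral_sq η hU v
      (fun k r => continuous_secondMoment ε x η ht i k r) _ fun l k r a b =>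
        fourierCoeffMatrix_secondMoment_eq_sum η ε x (hU.isIUR l).continuous (v l) (hv l) ht
          i k r a b
    simp only [ENNReal.toReal_ofNat, Real.rpow_ofNat]
    exact (hsum _ _ h).summable
  have hdist : ∀ i j, diffDist η ε x t i j = ‖(⟨ψ i, hmem i⟩ - ⟨ψ j, hmem j⟩ :
      lp (fun _ : (Σ l : I, Fin (N * d l) × Fin (N * d l)) => ℂ) 2)‖ := by
    intro i j
    have h1 := hsum _ _ (hasSum_diffDist_sq η ε x hU v hv ht i j)
    have h2 := lp.norm_rpow_eq_tsum (p := 2) (by norm_num) (⟨ψ i, hmem i⟩ - ⟨ψ j, hmem j⟩ :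
      lp (fun _ : (Σ l : I, Fin (N * d l) × Fin (N * d l)) => ℂ) 2)
    have h3 : 0 ≤ diffDist η ε x t i j := Real.sqrt_nonneg _
    refine (sq_eq_sq₀ h3 (norm_nonneg _)).1 ?_
    rw [← h1.tsum_eq]
    simp only [ENNReal.toReal_ofNat, Real.rpow_ofNat] at h2
    rw [h2]
    refine tsum_congr fun s => ?_
    rw [mul_sub]
    rfl
  refine ⟨fun i k r => ?_, fun i j => ?_, fun i => ⟨ψ i, hmem i⟩, fun i l n n' => ?_, hdist,
    fun i j hA => ?_⟩
  · exact (continuous_secondMoment ε x η ht i k r).memLp_of_hasCompactSupport (.of_compactSpace _)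
  · refine (hasSum_diffDist_sq η ε x hU v hv ht i j).congr_fun fun l => ?_
    congr 1
    refine Finset.sum_congr rfl fun n _ => Finset.sum_congr rfl fun n' _ => ?_
    have h : (lam l n * lam l n') ^ (2 * t) = |lam l n ^ t * lam l n' ^ t| ^ 2 := by
      rw [sq_abs, ← mul_pow, ← pow_mul, mul_comm t 2]
    rw [momentCoeff, momentCoeff, ← mul_sub, norm_mul, Complex.norm_real, Real.norm_eq_abs, h,
      ← mul_pow]
  · change ((√(d l : ℝ) : ℝ) : ℂ) * (_ * _) = _
    rw [← mul_assoc, ← Complex.ofReal_mul]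
  · obtain ⟨A, hA⟩ := hA
    -- Equality of the sequences follows from vanishing distance; no transformation rule for
    -- eigenvector blocks is needed.
    have h0 : diffDist η ε x t i j = 0 := by
      simp [diffDist, secondMoment_of_eq_act ε η hA ht]
    rw [hdist, norm_eq_zero, sub_eq_zero] at h0
    exact h0
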